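/- **Theorem (computational lower bound for estimating $x^\star$).** Let $n,d\ge 1$ be integers, $K_n\in\{1,\dots,n\}$, $K_d\in\{1,\dots,d\}$ and $\lambda\in[0,1]$. Let $S\subset\{1,\dots,n\}$ and $T\subset\{1,\dots,d\}$ be independent random subsets, where each $i$ belongs to $S$ independently with probability $K_n/n$ and each $k$ belongs to $T$ independently with probability $K_d/d$. Put $M=\lambda\mathbf 1\{S\times T\}$, i.e. $M_{i,k}=\lambda$ if $i\in S$ and $k\in T$, and $M_{i,k}=0$ otherwise. Conditionally on $(S,T)$, the entries of $Y\in\{-1,1\}^{n\times d}$ are independent with $\mathbb P(Y_{i,k}=\pm1\mid S,T)=(1\pm M_{i,k})/2$. Write $\mathbb E$ for the expectation under the joint law of $(S,T,Y)$, and let $x^\star=\mathbf 1\{\exists k:\ M_{1,k}>0\}$ be the indicator that the first row meets the hidden block. There is a universal constant $c_0>0$ such that the following holds for every $c_{\mathrm s}\ge c_0$, every integer $D\ge 2$ and all $n,d,K_n,K_d,\lambda$ as above. If $$\frac{K_n}{n}\ \vee\ \frac{K_d}{d}\ \vee\ \frac{\lambda K_n}{\sqrt n}\ \vee\ \frac{\lambda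 K_d}{\sqrt d}\ \vee\ \lambda\ \le\ D^{-8c_{\mathrm s}},$$ then every real polynomial $f$ of total degree at most $D$ in the $nd$ entries of $Y$ satisfies $$\mathbb E\big[(f(Y)-x^\star)^2\big]\ \ge\ \frac{\mathbb E[x^{\star 2}]}{2}.$$ The same inequality holds when $x^\star$ is replaced by $\mathbf 1\{1\in S\}$ (which differs from $x^\star$ only when $\lambda=0$ or $T=\emptyset$). -/

import Mathlib

namespace HiddenBlock

noncomputable section

/-- The block matrix `M = lam * 1{S × T}`. -/
def blockMatrix {n d : ℕ} (lam : ℝ) (S : Finset (Fin n)) (T : Finset (Fin d)) :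
    Matrix (Fin n) (Fin d) ℝ :=
  fun i k => if i ∈ S ∧ k ∈ T then lam else 0

/-- Probability of the random subset `S` of `[m]` when each element is included independently
with probability `p`. -/
def subsetProb {m : ℕ} (p : ℝ) (S : Finset (Fin m)) : ℝ :=
  ∏ i, if i ∈ S then p else 1 - p

/-- Sign matrices, i.e. elements of `{-1, 1}^{n × d}`. -/
abbrev SignMatrix (n d : ℕ) : Type := Fin n → Fin d → ℤˣ

/-- The `(i, k)` entry of a sign matrix, as a real number. -/
def entry {n d : ℕ} (Y : SignMatrix n d) (ik : Fin n × Fin d) : ℝ :=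
  ((Y ik.1 ik.2 : ℤ) : ℝ)

/-- Conditional probability of `Y` given `M`: the entries of `Y` are independent, valued in
`{-1, 1}`, and `Y i k` has mean `M i k`, so that `P(Y i k = y) = (1 + y * M i k) / 2`. -/
def obsProb {n d : ℕ} (M : Matrix (Fin n) (Fin d) ℝ) (Y : SignMatrix n d) : ℝ :=
  ∏ ik : Fin n × Fin d, (1 + entry Y ik * M ik.1 ik.2) / 2

/-- Joint probability of `(S, T, Y)`: rows are selected independently with probability `Kn / n`,
columns independently with probability `Kd / d`, and `Y` is observed given
`M = lam * 1{S × T}`. -/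
def jointProb {n d : ℕ} (lam : ℝ) (Kn Kd : ℕ)
    (S : Finset (Fin n)) (T : Finset (Fin d)) (Y : SignMatrix n d) : ℝ :=
  subsetProb ((Kn : ℝ) / n) S * subsetProb ((Kd : ℝ) / d) T * obsProb (blockMatrix lam S T) Y

/-- Expectation of a function `g` of `(S, T, Y)` in this (finite) model. -/
def expectation (n d : ℕ) (lam : ℝ) (Kn Kd : ℕ)
    (g : Finset (Fin n) → Finset (Fin d) → SignMatrix n d → ℝ) : ℝ :=
  ∑ S, ∑ T, ∑ Y, jointProb lam Kn Kd S T Y * g S T Y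

open Classical in
/-- The indicator that row `i` of `M` has a positive entry. -/
def rowPositive {n d : ℕ} (M : Matrix (Fin n) (Fin d) ℝ) (i : Fin n) : ℝ :=
  if ∃ k, 0 < M i k then 1 else 0

/-- The indicator that row `i` belongs to `S`. -/
def rowSelected {n : ℕ} (S : Finset (Fin n)) (i : Fin n) : ℝ :=
  if i ∈ S then 1 else 0

/-- Value at the observation `Y` of a polynomial in the `n * d` entries. -/
def polyValue {n d : ℕ} (f : MvPolynomial (Fin n × Fin d) ℝ) (Y : SignMatrix n d) : ℝ :=
  MvPolynomial.eval (entry Y) f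

/-- The signal condition: all five quantities are at most `D ^ (-8 c)`. -/
def SignalCondition (n d D : ℕ) (lam : ℝ) (Kn Kd : ℕ) (c : ℝ) : Prop :=
  max (max (max (max ((Kn : ℝ) / n) ((Kd : ℝ) / d)) (lam * Kn / Real.sqrt n))
    (lam * Kd / Real.sqrt d)) lam ≤ (D : ℝ) ^ (-8 * c)

theorem sum_subsetProb {m : ℕ} (p : ℝ) : ∑ S : Finset (Fin m), subsetProb p S = 1 := by
  have h := Finset.prod_add (fun _ : Fin m => p) (fun _ => 1 - p) Finset.univ
  simp only [add_sub_cancel, Finset.prod_const_one, Finset.powerset_univ] at h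
  rw [h]
  refine Finset.sum_congr rfl fun S _ => ?_
  rw [subsetProb, Finset.prod_ite]
  congr 1 <;> exact Finset.prod_congr (by ext; simp) fun _ _ => rfl

theorem sum_obsProb {n d : ℕ} (M : Matrix (Fin n) (Fin d) ℝ) :
    ∑ Y : SignMatrix n d, obsProb M Y = 1 := by
  have h1 : ∀ i k, ∑ u : ℤˣ, (1 + ((u : ℤ) : ℝ) * M i k) / 2 = 1 := by
    intro i k
    rw [show (Finset.univ : Finset ℤˣ) = {1, -1} from rfl, Finset.sum_pair (by decide)]
    push_cast
    ring
  simp only [obsProb, entry, Fintype.prod_prod_type]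
  rw [← Fintype.piFinset_univ, ← Finset.prod_univ_sum (fun _ => Finset.univ)
    (fun i (y : Fin d → ℤˣ) => ∏ k, (1 + ((y k : ℤ) : ℝ) * M i k) / 2)]
  refine Finset.prod_eq_one fun i _ => ?_
  rw [← Fintype.piFinset_univ, ← Finset.prod_univ_sum (fun _ => Finset.univ)
    (fun k (u : ℤˣ) => (1 + ((u : ℤ) : ℝ) * M i k) / 2)]
  exact Finset.prod_eq_one fun k _ => h1 i k

/-- The total mass is one. -/
theorem expectation_one {n d : ℕ} (lam : ℝ) (Kn Kd : ℕ) :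
    expectation n d lam Kn Kd (fun _ _ _ => 1) = 1 := by
  simp only [expectation, jointProb, mul_one, ← Finset.mul_sum, sum_obsProb, sum_subsetProb]

/-- The joint probabilities are nonnegative. -/
theorem jointProb_nonneg {n d : ℕ} {lam : ℝ} (h0 : 0 ≤ lam) (h1 : lam ≤ 1) {Kn Kd : ℕ}
    (hn : Kn ≤ n) (hd : Kd ≤ d)
    (S : Finset (Fin n)) (T : Finset (Fin d)) (Y : SignMatrix n d) :
    0 ≤ jointProb lam Kn Kd S T Y := by
  have key : ∀ {m K : ℕ} (_ : K ≤ m) (U : Finset (Fin m)), 0 ≤ subsetProb ((K : ℝ) / m) U := by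
    intro m K h U
    refine Finset.prod_nonneg fun i _ => ?_
    have : (K : ℝ) / m ≤ 1 := div_le_one_of_le₀ (by exact_mod_cast h) (by positivity)
    split_ifs
    · positivity
    · linarith
  refine mul_nonneg (mul_nonneg (key hn S) (key hd T)) (Finset.prod_nonneg fun ik _ => ?_)
  have hM : 0 ≤ blockMatrix lam S T ik.1 ik.2 ∧ blockMatrix lam S T ik.1 ik.2 ≤ 1 := by
    unfold blockMatrix
    split_ifs <;> constructor <;> linarith
  rcases Int.units_eq_one_or (Y ik.1 ik.2) with h | h <;> simp only [entry, h] <;> push_cast <;>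
    linarith [hM.1, hM.2]

end

end HiddenBlock

namespace HiddenBlock

open Finset

section Sums

variable {ι κ : Type*} [DecidableEq κ]

/-! The proof is by duality. If a random variable `W` satisfies E[W f] = E[x f] for every polynomial
`f` of degree at most `D`, then expanding E[(f - W)²] ≥ 0 gives E[(f - x)²] ≥ E[x²] - E[W²]
(`expectation_sq_sub_le_of_dual`). It remains to find such a `W` with small second moment.

For x = 1{z ∈ S} take W = ∑ κ_b ∏_{e ∈ b} (Y_e - M_e)/(1 - M_e²) over edge sets `b` of size at most
`D`. Given M, these products are orthogonal, and their correlation with the monomial Y^a is M^(a \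
b) if b ⊆ a and 0 otherwise. Matching correlations therefore means ∑_{b ⊆ a} κ_b E[M^(a \ b)] = E[x
M^a], which is the recursion defining the joint cumulants of x and the entries of M.

Write p = Kn/n. Cumulants vanish unless `b` is connected to the row `z`, and |κ_b| ≤ (|b| + 1)^|b|
E[x M^b]. Growing connected sets one edge at a time, the signal condition makes each new edge cost a
factor at most 1/2 in the sum of squares, so E[W²] ≤ 2p², well below E[x²] = p
(`sum_rootedCumulant_sq_le`). For x⋆ the certificate is corrected on the event T = ∅, where Y
carries no information on S. -/

theorem sum_biUnion_le_sum {s : Finset ι} {t : ι → Finset κ} {g : κ → ℝ} (hg : ∀ x, 0 ≤ g x) :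
    ∑ x ∈ s.biUnion t, g x ≤ ∑ i ∈ s, ∑ x ∈ t i, g x := by
  classical
  induction s using Finset.induction_on with
  | empty => simp
  | insert i s hi ih =>
    rw [biUnion_insert, sum_insert hi]
    have := sum_union_inter (s₁ := t i) (s₂ := s.biUnion t) (f := g)
    have := sum_nonneg fun x (_ : x ∈ t i ∩ s.biUnion t) => hg x
    linarith

end Sums

/-! ### Moments and cumulants of the hidden block -/

section Cumulants

variable {n d : ℕ}

/-- The moment `E[∏ X]` over the edges `a` of a bipartite graph. -/
noncomputable def edgeMoment (lam p q : ℝ) (a : Finset (Fin n × Fin d)) : ℝ :=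
  lam ^ #a * p ^ #(a.image Prod.fst) * q ^ #(a.image Prod.snd)

/-- The moment `E[1{z ∈ S} ∏ X]` over the edges `a` of a bipartite graph. -/
noncomputable def rootedMoment (lam p q : ℝ) (z : Fin n) (a : Finset (Fin n × Fin d)) : ℝ :=
  lam ^ #a * p ^ #(insert z (a.image Prod.fst)) * q ^ #(a.image Prod.snd)

/-- The joint cumulant of `1{z ∈ S}` and the entries of `X` indexed by `a`, defined by the
recursion expressing the rooted moments through the cumulants and the moments. -/
noncomputable def rootedCumulant (lam p q : ℝ) (z : Fin n) (a : Finset (Fin n × Fin d)) : ℝ :=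
  Finset.strongInduction (p := fun _ => ℝ) (fun s ih => rootedMoment lam p q z s -
    ∑ t ∈ s.ssubsets.attach, ih t.1 (mem_ssubsets.1 t.2) * edgeMoment lam p q (s \ t.1)) a

variable {lam p q : ℝ} {z : Fin n} {a b : Finset (Fin n × Fin d)}

theorem rootedCumulant_eq (a : Finset (Fin n × Fin d)) :
    rootedCumulant lam p q z a = rootedMoment lam p q z a -
      ∑ b ∈ a.ssubsets, rootedCumulant lam p q z b * edgeMoment lam p q (a \ b) := by
  rw [rootedCumulant, Finset.strongInduction_eq]
  congr 1
  exact sum_attach a.ssubsets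
    (fun b => rootedCumulant lam p q z b * edgeMoment lam p q (a \ b))

theorem sum_powerset_eq_add_sum_ssubsets (a : Finset (Fin n × Fin d))
    (g : Finset (Fin n × Fin d) → ℝ) :
    ∑ b ∈ a.powerset, g b = g a + ∑ b ∈ a.ssubsets, g b := by
  rw [ssubsets, add_sum_erase _ _ (mem_powerset_self a)]

theorem sum_rootedCumulant_mul_edgeMoment (a : Finset (Fin n × Fin d)) :
    ∑ b ∈ a.powerset, rootedCumulant lam p q z b * edgeMoment lam p q (a \ b) =
      rootedMoment lam p q z a := by
  rw [sum_powerset_eq_add_sum_ssubsets, rootedCumulant_eq a]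
  simp [edgeMoment]

theorem edgeMoment_nonneg (h0 : 0 ≤ lam) (hp : 0 ≤ p) (hq : 0 ≤ q) (a : Finset (Fin n × Fin d)) :
    0 ≤ edgeMoment lam p q a := by unfold edgeMoment; positivity

theorem rootedMoment_nonneg (h0 : 0 ≤ lam) (hp : 0 ≤ p) (hq : 0 ≤ q)
    (a : Finset (Fin n × Fin d)) : 0 ≤ rootedMoment lam p q z a := by
  unfold rootedMoment; positivity

/-- Edges add up, while a vertex shared by the two parts is counted twice on the left; as p, q ≤ 1,
this only makes the product smaller. -/
theorem rootedMoment_mul_edgeMoment_le (h0 : 0 ≤ lam) (hp : 0 ≤ p) (hp1 : p ≤ 1) (hq : 0 ≤ q)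
    (hq1 : q ≤ 1) (hba : b ⊆ a) :
    rootedMoment lam p q z b * edgeMoment lam p q (a \ b) ≤ rootedMoment lam p q z a := by
  have hcard : #a = #b + #(a \ b) := by
    rw [add_comm, card_sdiff_add_card_eq_card hba]
  have hrow : #(insert z (a.image Prod.fst)) ≤
      #(insert z (b.image Prod.fst)) + #((a \ b).image Prod.fst) := by
    rw [← union_sdiff_of_subset hba, image_union, ← insert_union, union_sdiff_of_subset hba]
    exact card_union_le _ _
  have hcol : #(a.image Prod.snd) ≤ #(b.image Prod.snd) + #((a \ b).image Prod.snd) := by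
    rw [← union_sdiff_of_subset hba, image_union, union_sdiff_of_subset hba]
    exact card_union_le _ _
  calc rootedMoment lam p q z b * edgeMoment lam p q (a \ b)
      = lam ^ #a * p ^ (#(insert z (b.image Prod.fst)) + #((a \ b).image Prod.fst)) *
          q ^ (#(b.image Prod.snd) + #((a \ b).image Prod.snd)) := by
        rw [rootedMoment, edgeMoment, hcard]; ring
    _ ≤ rootedMoment lam p q z a := by
        unfold rootedMoment
        gcongr ?_ * ?_ * ?_
        · exact pow_le_pow_of_le_one hp hp1 hrow
        · exact pow_le_pow_of_le_one hq hq1 hcol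

/-- Induction on the recursion: a proper subset satisfies |b| + 1 ≤ |a|, so its term is at most
|a|^|b| times the moment of `a`, and the binomial theorem sums these weights. -/
theorem abs_rootedCumulant_le (h0 : 0 ≤ lam) (hp : 0 ≤ p) (hp1 : p ≤ 1) (hq : 0 ≤ q)
    (hq1 : q ≤ 1) (a : Finset (Fin n × Fin d)) :
    |rootedCumulant lam p q z a| ≤ ((#a : ℝ) + 1) ^ #a * rootedMoment lam p q z a := by
  induction a using Finset.strongInduction with
  | H a ih =>
    have hc := rootedMoment_nonneg (z := z) h0 hp hq a
    have hterm : ∀ b ∈ a.ssubsets,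
        |rootedCumulant lam p q z b * edgeMoment lam p q (a \ b)| ≤
          (#a : ℝ) ^ #b * rootedMoment lam p q z a := by
      intro b hb
      rw [mem_ssubsets] at hb
      have hlt : (#b : ℝ) + 1 ≤ #a := by exact_mod_cast card_lt_card hb
      have hm := edgeMoment_nonneg h0 hp hq (a \ b)
      rw [abs_mul, abs_of_nonneg hm]
      calc _ ≤ ((#b : ℝ) + 1) ^ #b * rootedMoment lam p q z b * edgeMoment lam p q (a \ b) := by
            gcongr; exact ih b hb
        _ = ((#b : ℝ) + 1) ^ #b * (rootedMoment lam p q z b * edgeMoment lam p q (a \ b)) := by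
            ring
        _ ≤ (#a : ℝ) ^ #b * rootedMoment lam p q z a := by
            have := rootedMoment_mul_edgeMoment_le (z := z) h0 hp hp1 hq hq1 hb.subset
            have := rootedMoment_nonneg (z := z) h0 hp hq b
            gcongr
    have hsum : (#a : ℝ) ^ #a + ∑ b ∈ a.ssubsets, (#a : ℝ) ^ #b = ((#a : ℝ) + 1) ^ #a := by
      rw [← sum_powerset_eq_add_sum_ssubsets a (fun b => (#a : ℝ) ^ #b),
        ← sum_pow_mul_eq_add_pow]
      simp
    -- This absorbs the leading moment into the missing term b = a; the empty set relies on 0 ^ 0 =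
    -- 1.
    have hone : (1 : ℝ) ≤ (#a : ℝ) ^ #a := by exact_mod_cast Nat.one_le_iff_ne_zero.2 (by
      rcases Nat.eq_zero_or_pos #a with h | h
      · simp [h]
      · positivity)
    calc |rootedCumulant lam p q z a|
        ≤ |rootedMoment lam p q z a| +
          |∑ b ∈ a.ssubsets, rootedCumulant lam p q z b * edgeMoment lam p q (a \ b)| := by
          rw [rootedCumulant_eq]; exact abs_sub _ _
      _ ≤ rootedMoment lam p q z a +
          ∑ b ∈ a.ssubsets, (#a : ℝ) ^ #b * rootedMoment lam p q z a := by
          rw [abs_of_nonneg hc]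
          gcongr
          exact (abs_sum_le_sum_abs _ _).trans (sum_le_sum hterm)
      _ ≤ ((#a : ℝ) + 1) ^ #a * rootedMoment lam p q z a := by
          rw [← sum_mul, ← hsum]
          nlinarith

/-- The edges `b` share no vertex with the edges `a` nor with the row `z`. -/
def Separated (z : Fin n) (a b : Finset (Fin n × Fin d)) : Prop :=
  Disjoint (insert z (a.image Prod.fst)) (b.image Prod.fst) ∧
    Disjoint (a.image Prod.snd) (b.image Prod.snd)

theorem Separated.disjoint (h : Separated z a b) : Disjoint a b := by
  rw [disjoint_left]
  intro e ha hb
  exact disjoint_left.1 h.2 (mem_image_of_mem _ ha) (mem_image_of_mem _ hb)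

theorem Separated.mono {a' b' : Finset (Fin n × Fin d)} (h : Separated z a b) (ha : a' ⊆ a)
    (hb : b' ⊆ b) : Separated z a' b' :=
  ⟨h.1.mono (insert_subset_insert _ (image_subset_image ha)) (image_subset_image hb),
    h.2.mono (image_subset_image ha) (image_subset_image hb)⟩

theorem Separated.rootedMoment_union (h : Separated z a b) :
    rootedMoment lam p q z (a ∪ b) = rootedMoment lam p q z a * edgeMoment lam p q b := by
  rw [rootedMoment, rootedMoment, edgeMoment, card_union_of_disjoint h.disjoint, image_union,
    image_union, ← insert_union, card_union_of_disjoint h.1, card_union_of_disjoint h.2]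
  ring

theorem Separated.edgeMoment_union (h : Separated z a b) :
    edgeMoment lam p q (a ∪ b) = edgeMoment lam p q a * edgeMoment lam p q b := by
  rw [edgeMoment, edgeMoment, edgeMoment, card_union_of_disjoint h.disjoint, image_union,
    image_union, card_union_of_disjoint (h.1.mono_left (subset_insert _ _)),
    card_union_of_disjoint h.2]
  ring

/-- A cumulant of variables that split into two independent blocks vanishes. In the recursion,
proper subsets meeting `b` drop out by induction; the subsets of `a` reassemble to the moment of `a`
times that of `b`, which cancels the leading moment. -/
theorem Separated.rootedCumulant_union (h : Separated z a b) (hb : b.Nonempty) :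
    rootedCumulant lam p q z (a ∪ b) = 0 := by
  generalize hs : a ∪ b = s
  induction s using Finset.strongInduction generalizing a b with
  | H s ih =>
    subst hs
    have hnot : ¬ (a ∪ b) ⊆ a := by
      intro hsub
      obtain ⟨e, he⟩ := hb
      exact disjoint_left.1 h.disjoint (hsub (mem_union_right _ he)) he
    have hsplit : ∑ s ∈ (a ∪ b).ssubsets,
        rootedCumulant lam p q z s * edgeMoment lam p q ((a ∪ b) \ s) =
        ∑ s ∈ a.powerset, rootedCumulant lam p q z s * edgeMoment lam p q ((a ∪ b) \ s) := by
      symm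
      apply sum_subset
      · intro s hs
        rw [mem_powerset] at hs
        rw [mem_ssubsets]
        exact ⟨hs.trans subset_union_left, fun h' => hnot (h'.trans hs)⟩
      · intro s hs hsa
        rw [mem_ssubsets] at hs
        rw [mem_powerset] at hsa
        have hu : (s ∩ a) ∪ (s ∩ b) = s := by
          rw [← inter_union_distrib_left, inter_eq_left.2 hs.subset]
        have hne : (s ∩ b).Nonempty := by
          rw [nonempty_iff_ne_empty]
          intro h'
          rw [h', union_empty] at hu
          exact hsa (inter_eq_left.1 hu)
        rw [ih s hs (h.mono inter_subset_right inter_subset_right) hne hu, zero_mul]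
    have hfac : ∀ s ∈ a.powerset,
        rootedCumulant lam p q z s * edgeMoment lam p q ((a ∪ b) \ s) =
        rootedCumulant lam p q z s * edgeMoment lam p q (a \ s) * edgeMoment lam p q b := by
      intro s hs
      rw [mem_powerset] at hs
      have : (a ∪ b) \ s = (a \ s) ∪ b := by
        rw [union_sdiff_distrib, sdiff_eq_self_of_disjoint (h.disjoint.symm.mono_right hs)]
      rw [this, (h.mono sdiff_subset subset_rfl).edgeMoment_union, mul_assoc]
    rw [rootedCumulant_eq, hsplit, sum_congr rfl hfac, ← sum_mul,
      sum_rootedCumulant_mul_edgeMoment, h.rootedMoment_union, sub_self]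

end Cumulants

/-! ### Growing connected edge sets from the root row -/

section Growth

variable {n d : ℕ}

/-- The edges outside `a` that share a vertex with `a` or contain the row `z`. -/
def boundaryEdges (z : Fin n) (a : Finset (Fin n × Fin d)) : Finset (Fin n × Fin d) :=
  univ.filter fun e =>
    e ∉ a ∧ (e.1 ∈ insert z (a.image Prod.fst) ∨ e.2 ∈ a.image Prod.snd)

/-- The sets of `k` edges obtained by successively attaching edges to the row `z`. -/
def grownSets (d : ℕ) (z : Fin n) : ℕ → Finset (Finset (Fin n × Fin d))
  | 0 => {∅}
  | k + 1 => (grownSets d z k).biUnion fun a => (boundaryEdges z a).image fun e => insert e a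

variable {lam p q : ℝ} {z : Fin n} {a : Finset (Fin n × Fin d)}

theorem card_of_mem_grownSets {k : ℕ} (h : a ∈ grownSets d z k) : #a = k := by
  induction k generalizing a with
  | zero => simp_all [grownSets]
  | succ k ih =>
    simp only [grownSets, mem_biUnion, mem_image] at h
    obtain ⟨b, hb, e, he, rfl⟩ := h
    rw [card_insert_of_notMem (mem_filter.1 he).2.1, ih hb]

/-- Only sets of edges attached to the row `z` have a nonzero cumulant. -/
theorem mem_grownSets_of_rootedCumulant_ne_zero (h : rootedCumulant lam p q z a ≠ 0) :
    a ∈ grownSets d z #a := by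
  -- Take a largest grown subset `b` of `a`. By maximality no remaining edge touches it, so a
  -- nonempty remainder would be separated and the cumulant zero.
  obtain ⟨b, hb, hmax⟩ := exists_max_image (a.powerset.filter fun b => b ∈ grownSets d z #b)
    card ⟨∅, by simp [grownSets]⟩
  simp only [mem_filter, mem_powerset] at hb hmax
  have hsep : Separated z b (a \ b) := by
    have key : ∀ e ∈ a \ b,
        ¬ (e.1 ∈ insert z (b.image Prod.fst) ∨ e.2 ∈ b.image Prod.snd) := by
      intro e he htouch
      rw [mem_sdiff] at he
      have hcard := card_insert_of_notMem he.2
      have := hmax (insert e b) ⟨insert_subset he.1 hb.1, by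
        rw [hcard, grownSets, mem_biUnion]
        exact ⟨b, hb.2, mem_image.2
          ⟨e, mem_filter.2 ⟨mem_univ _, he.2, htouch⟩, rfl⟩⟩⟩
      omega
    constructor <;> rw [disjoint_right] <;> intro v hv <;> obtain ⟨e, he, rfl⟩ := mem_image.1 hv
    · exact fun h' => key e he (Or.inl h')
    · exact fun h' => key e he (Or.inr h')
  rcases (a \ b).eq_empty_or_nonempty with hE | hE
  · rw [sdiff_eq_empty_iff_subset] at hE
    rw [← hb.1.antisymm hE]
    exact hb.2
  · have := hsep.rootedCumulant_union (lam := lam) (p := p) (q := q) hE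
    rw [union_sdiff_of_subset hb.1] at this
    exact absurd this h

theorem rootedMoment_insert {e : Fin n × Fin d} (he : e ∉ a) :
    rootedMoment lam p q z (insert e a) = rootedMoment lam p q z a *
      (lam * (if e.1 ∈ insert z (a.image Prod.fst) then 1 else p) *
        (if e.2 ∈ a.image Prod.snd then 1 else q)) := by
  rw [rootedMoment, rootedMoment, card_insert_of_notMem he, image_insert, image_insert,
    insert_comm, card_insert_eq_ite, card_insert_eq_ite (s := a.image Prod.snd)]
  split_ifs <;> ring

/-- Three kinds of edges attach to `a`: both ends old, only the row old (at most `d` columns, each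
weighted q²), only the column old (at most `n` rows, each weighted p²). Edges with two new ends,
which would contribute n d p² q², are not boundary edges. -/
theorem sum_boundaryEdges_rootedMoment_sq_le (hp : 0 ≤ p) (hp1 : p ≤ 1) (hq : 0 ≤ q)
    (hq1 : q ≤ 1) :
    ∑ e ∈ boundaryEdges z a, rootedMoment lam p q z (insert e a) ^ 2 ≤
      rootedMoment lam p q z a ^ 2 *
        (lam ^ 2 * ((#a + 1) * #a + (#a + 1) * (d * q ^ 2) + n * p ^ 2 * #a)) := by
  set A := insert z (a.image Prod.fst) with hA
  set B := a.image Prod.snd with hB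
  have hAc : (#A : ℝ) ≤ #a + 1 := by
    exact_mod_cast (card_insert_le _ _).trans (Nat.succ_le_succ card_image_le)
  have hBc : (#B : ℝ) ≤ #a := by exact_mod_cast card_image_le
  let r : Fin n → ℝ := fun i => if i ∈ A then 1 else 0
  let s : Fin d → ℝ := fun k => if k ∈ B then 1 else 0
  have hr : ∑ i, r i = #A := by simp [r]
  have hs : ∑ k, s k = #B := by simp [s]
  have hp2 : p ^ 2 ≤ 1 := pow_le_one₀ hp hp1
  have hq2 : q ^ 2 ≤ 1 := pow_le_one₀ hq hq1
  have hp0 := sq_nonneg p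
  have hq0 := sq_nonneg q
  -- The majorant is a sum of products of a row function and a column function, so it can be summed
  -- over all pairs.
  have hpt : ∀ e ∈ boundaryEdges z a, rootedMoment lam p q z (insert e a) ^ 2 ≤
      rootedMoment lam p q z a ^ 2 *
        (lam ^ 2 * (r e.1 * s e.2 + r e.1 * q ^ 2 + p ^ 2 * s e.2)) := by
    intro e he
    obtain ⟨-, hea, ht⟩ := mem_filter.1 he
    rw [rootedMoment_insert hea, mul_pow, mul_assoc lam, mul_pow lam]
    gcongr
    simp only [r, s, ← hA, ← hB] at ht ⊢
    rcases ht with ht | ht <;> simp only [ht, if_true] <;> split_ifs <;> nlinarith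
  have hnn : ∀ e ∈ (univ : Finset (Fin n × Fin d)), e ∉ boundaryEdges z a →
      0 ≤ rootedMoment lam p q z a ^ 2 *
        (lam ^ 2 * (r e.1 * s e.2 + r e.1 * q ^ 2 + p ^ 2 * s e.2)) := by
    intro e _ _
    have : 0 ≤ r e.1 := by simp only [r]; split_ifs <;> norm_num
    have : 0 ≤ s e.2 := by simp only [s]; split_ifs <;> norm_num
    positivity
  refine (sum_le_sum hpt).trans ((sum_le_sum_of_subset_of_nonneg (subset_univ _) hnn).trans ?_)
  rw [← mul_sum, ← mul_sum]
  have htot : ∑ e : Fin n × Fin d, (r e.1 * s e.2 + r e.1 * q ^ 2 + p ^ 2 * s e.2) =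
      #A * #B + #A * (d * q ^ 2) + n * p ^ 2 * #B := by
    simp only [Fintype.sum_prod_type, sum_add_distrib, ← mul_sum, ← sum_mul, hr, hs, sum_const,
      card_univ, Fintype.card_fin, nsmul_eq_mul]
    ring
  rw [htot]
  gcongr

/-- Iterates the one-edge bound. A set reachable in several orders is counted several times, which
is harmless for an upper bound. -/
theorem sum_grownSets_rootedMoment_sq_le {eps : ℝ} (hp : 0 ≤ p) (hp1 : p ≤ 1)
    (hq : 0 ≤ q) (hq1 : q ≤ 1) (hlam : lam ^ 2 ≤ eps) (hlp : lam ^ 2 * (n * p ^ 2) ≤ eps)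
    (hlq : lam ^ 2 * (d * q ^ 2) ≤ eps) {D k : ℕ} (hk : k ≤ D) :
    ∑ a ∈ grownSets d z k, rootedMoment lam p q z a ^ 2 ≤
      p ^ 2 * (3 * (D + 1) ^ 2 * eps) ^ k := by
  have heps : 0 ≤ eps := (sq_nonneg lam).trans hlam
  induction k with
  | zero => simp [grownSets, rootedMoment]
  | succ k ih =>
    have hkD : (k : ℝ) ≤ D := by exact_mod_cast (Nat.le_succ k).trans hk
    calc ∑ a ∈ grownSets d z (k + 1), rootedMoment lam p q z a ^ 2
        ≤ ∑ a ∈ grownSets d z k, ∑ e ∈ boundaryEdges z a,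
            rootedMoment lam p q z (insert e a) ^ 2 := by
          rw [grownSets]
          refine (sum_biUnion_le_sum fun _ => sq_nonneg _).trans (sum_le_sum fun a _ => ?_)
          exact sum_image_le_of_nonneg fun _ _ => sq_nonneg _
      _ ≤ ∑ a ∈ grownSets d z k, rootedMoment lam p q z a ^ 2 * (3 * (D + 1) ^ 2 * eps) := by
          refine sum_le_sum fun a ha => (sum_boundaryEdges_rootedMoment_sq_le hp hp1 hq hq1).trans ?_
          rw [card_of_mem_grownSets ha]
          refine mul_le_mul_of_nonneg_left ?_ (sq_nonneg _)
          have h1 : ((k : ℝ) + 1) * k ≤ (D + 1) ^ 2 := by nlinarith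
          have h2 : (k : ℝ) + 1 ≤ (D + 1) ^ 2 := by nlinarith
          have h3 : (k : ℝ) ≤ (D + 1) ^ 2 := by nlinarith
          calc lam ^ 2 * (((k : ℝ) + 1) * k + (k + 1) * (d * q ^ 2) + n * p ^ 2 * k)
              = (k + 1) * k * lam ^ 2 + (k + 1) * (lam ^ 2 * (d * q ^ 2)) +
                  k * (lam ^ 2 * (n * p ^ 2)) := by ring
            _ ≤ (D + 1) ^ 2 * eps + (D + 1) ^ 2 * eps + (D + 1) ^ 2 * eps := by gcongr
            _ = 3 * (D + 1) ^ 2 * eps := by ring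
      _ ≤ p ^ 2 * (3 * (D + 1) ^ 2 * eps) ^ (k + 1) := by
          rw [← sum_mul, pow_succ _ k, ← mul_assoc (p ^ 2)]
          exact mul_le_mul_of_nonneg_right (ih (by omega)) (by positivity)

end Growth

/-! ### Expectations in the finite model and moments of the block matrix -/

section Expectation

variable {n d : ℕ} {lam : ℝ} {Kn Kd : ℕ}

theorem expectation_add (g h : Finset (Fin n) → Finset (Fin d) → SignMatrix n d → ℝ) :
    expectation n d lam Kn Kd (fun S T Y => g S T Y + h S T Y) =
      expectation n d lam Kn Kd g + expectation n d lam Kn Kd h := by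
  simp only [expectation, mul_add, sum_add_distrib]

theorem expectation_sub (g h : Finset (Fin n) → Finset (Fin d) → SignMatrix n d → ℝ) :
    expectation n d lam Kn Kd (fun S T Y => g S T Y - h S T Y) =
      expectation n d lam Kn Kd g - expectation n d lam Kn Kd h := by
  simp only [expectation, mul_sub, sum_sub_distrib]

theorem expectation_const_mul (r : ℝ)
    (g : Finset (Fin n) → Finset (Fin d) → SignMatrix n d → ℝ) :
    expectation n d lam Kn Kd (fun S T Y => r * g S T Y) =
      r * expectation n d lam Kn Kd g := by
  simp only [expectation, mul_sum]
  exact sum_congr rfl fun _ _ => sum_congr rfl fun _ _ => sum_congr rfl fun _ _ => by ring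

theorem expectation_sum {ι : Type*} (s : Finset ι)
    (g : ι → Finset (Fin n) → Finset (Fin d) → SignMatrix n d → ℝ) :
    expectation n d lam Kn Kd (fun S T Y => ∑ i ∈ s, g i S T Y) =
      ∑ i ∈ s, expectation n d lam Kn Kd (g i) := by
  classical
  induction s using Finset.induction_on with
  | empty => simp [expectation]
  | insert i s hi ih => simp only [sum_insert hi, expectation_add, ih]

theorem expectation_mono (h0 : 0 ≤ lam) (h1 : lam ≤ 1) (hn : Kn ≤ n) (hd : Kd ≤ d)
    {g h : Finset (Fin n) → Finset (Fin d) → SignMatrix n d → ℝ}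
    (hgh : ∀ S T Y, g S T Y ≤ h S T Y) :
    expectation n d lam Kn Kd g ≤ expectation n d lam Kn Kd h :=
  sum_le_sum fun S _ => sum_le_sum fun T _ => sum_le_sum fun Y _ =>
    mul_le_mul_of_nonneg_left (hgh S T Y) (jointProb_nonneg h0 h1 hn hd S T Y)

theorem expectation_nonneg (h0 : 0 ≤ lam) (h1 : lam ≤ 1) (hn : Kn ≤ n) (hd : Kd ≤ d)
    {g : Finset (Fin n) → Finset (Fin d) → SignMatrix n d → ℝ} (hg : ∀ S T Y, 0 ≤ g S T Y) :
    0 ≤ expectation n d lam Kn Kd g := by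
  simpa [expectation] using expectation_mono (g := fun _ _ _ => 0) h0 h1 hn hd hg

theorem expectation_eq_of_cond
    (g : Finset (Fin n) → Finset (Fin d) → SignMatrix n d → ℝ)
    (G : Finset (Fin n) → Finset (Fin d) → ℝ)
    (h : ∀ S T, ∑ Y, obsProb (blockMatrix lam S T) Y * g S T Y = G S T) :
    expectation n d lam Kn Kd g = ∑ S, ∑ T,
      subsetProb ((Kn : ℝ) / n) S * subsetProb ((Kd : ℝ) / d) T * G S T := by
  refine sum_congr rfl fun S _ => sum_congr rfl fun T _ => ?_
  rw [← h, mul_sum]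
  exact sum_congr rfl fun Y _ => by rw [jointProb, mul_assoc]

/-- Expectation of a function of `(S, T)` that is a product. -/
theorem expectation_mul_of_indep (u : Finset (Fin n) → ℝ) (v : Finset (Fin d) → ℝ) :
    expectation n d lam Kn Kd (fun S T _ => u S * v T) =
      (∑ S, subsetProb ((Kn : ℝ) / n) S * u S) * ∑ T, subsetProb ((Kd : ℝ) / d) T * v T := by
  rw [expectation_eq_of_cond _ (fun S T => u S * v T), sum_mul_sum]
  · exact sum_congr rfl fun _ _ => sum_congr rfl fun _ _ => by ring
  · intro S T
    rw [← sum_mul, sum_obsProb, one_mul]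

/-- Giving exclusion weight 0 on `A` in the expansion of ∏ (p + weight) removes exactly the sets
that miss a point of `A`. -/
theorem sum_subsetProb_mul_subset {m : ℕ} (p : ℝ) (A : Finset (Fin m)) :
    ∑ S, subsetProb p S * (if A ⊆ S then 1 else 0) = p ^ #A := by
  have h := prod_add (fun _ : Fin m => p) (fun i => if i ∈ A then 0 else 1 - p) univ
  have hl : ∏ i : Fin m, (p + if i ∈ A then 0 else 1 - p) = p ^ #A := by
    rw [← prod_const, ← Fintype.prod_ite_mem A]
    exact prod_congr rfl fun i _ => by split_ifs <;> ring
  rw [← hl, h, powerset_univ]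
  refine sum_congr rfl fun S _ => ?_
  rw [subsetProb, prod_ite, filter_mem_eq_inter, univ_inter]
  have hc : univ.filter (fun i => i ∉ S) = univ \ S := by ext; simp
  rw [hc, mul_assoc]
  congr 1
  split_ifs with hA
  · rw [mul_one]
    exact prod_congr rfl fun i hi => by rw [if_neg fun h => (mem_sdiff.1 hi).2 (hA h)]
  · obtain ⟨i, hiA, hiS⟩ := not_subset.1 hA
    rw [mul_zero, prod_eq_zero (i := i) (by simpa using hiS) (by simp [hiA])]

theorem prod_blockMatrix (S : Finset (Fin n)) (T : Finset (Fin d)) (a : Finset (Fin n × Fin d)) :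
    ∏ e ∈ a, blockMatrix lam S T e.1 e.2 = lam ^ #a *
      ((if a.image Prod.fst ⊆ S then 1 else 0) * (if a.image Prod.snd ⊆ T then 1 else 0)) := by
  by_cases h : a.image Prod.fst ⊆ S ∧ a.image Prod.snd ⊆ T
  · rw [if_pos h.1, if_pos h.2, mul_one, mul_one, ← prod_const]
    exact prod_congr rfl fun e he =>
      if_pos ⟨h.1 (mem_image_of_mem _ he), h.2 (mem_image_of_mem _ he)⟩
  · have hz : ∃ e ∈ a, ¬ (e.1 ∈ S ∧ e.2 ∈ T) := by
      by_contra! hall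
      exact h ⟨image_subset_iff.2 fun e he => (hall e he).1,
        image_subset_iff.2 fun e he => (hall e he).2⟩
    obtain ⟨e, he, hne⟩ := hz
    rw [prod_eq_zero he (if_neg hne)]
    rw [not_and_or] at h
    rcases h with h | h <;> simp [h]

theorem expectation_prod_blockMatrix (a : Finset (Fin n × Fin d)) :
    expectation n d lam Kn Kd (fun S T _ => ∏ e ∈ a, blockMatrix lam S T e.1 e.2) =
      edgeMoment lam ((Kn : ℝ) / n) ((Kd : ℝ) / d) a := by
  simp only [prod_blockMatrix, expectation_const_mul]
  rw [expectation_mul_of_indep (fun S => if a.image Prod.fst ⊆ S then 1 else 0)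
    (fun T => if a.image Prod.snd ⊆ T then 1 else 0), sum_subsetProb_mul_subset,
    sum_subsetProb_mul_subset, edgeMoment, mul_assoc]

theorem expectation_rowSelected_mul_prod_blockMatrix (z : Fin n) (a : Finset (Fin n × Fin d)) :
    expectation n d lam Kn Kd
        (fun S T _ => rowSelected S z * ∏ e ∈ a, blockMatrix lam S T e.1 e.2) =
      rootedMoment lam ((Kn : ℝ) / n) ((Kd : ℝ) / d) z a := by
  have h : ∀ (S : Finset (Fin n)) (T : Finset (Fin d)),
      rowSelected S z * ∏ e ∈ a, blockMatrix lam S T e.1 e.2 = lam ^ #a *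
        ((if insert z (a.image Prod.fst) ⊆ S then 1 else 0) *
          (if a.image Prod.snd ⊆ T then 1 else 0)) := by
    intro S T
    simp only [prod_blockMatrix, rowSelected, insert_subset_iff]
    split_ifs <;> simp_all
  simp only [h, expectation_const_mul]
  rw [expectation_mul_of_indep (fun S => if insert z (a.image Prod.fst) ⊆ S then 1 else 0)
    (fun T => if a.image Prod.snd ⊆ T then 1 else 0), sum_subsetProb_mul_subset,
    sum_subsetProb_mul_subset, rootedMoment, mul_assoc]

end Expectation

/-! ### Conditional biorthogonality of the observations -/

section Observation

variable {n d : ℕ}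

theorem sum_units_int (g : ℤˣ → ℝ) : ∑ u, g u = g 1 + g (-1) := by
  rw [show (univ : Finset ℤˣ) = {1, -1} from rfl, sum_pair (by decide)]

theorem sum_obsProb_mul_prod (M : Matrix (Fin n) (Fin d) ℝ) (g : Fin n × Fin d → ℝ → ℝ) :
    ∑ Y, obsProb M Y * ∏ e, g e (entry Y e) =
      ∏ e, ((1 + M e.1 e.2) / 2 * g e 1 + (1 - M e.1 e.2) / 2 * g e (-1)) := by
  have h : ∀ e : Fin n × Fin d,
      (1 + M e.1 e.2) / 2 * g e 1 + (1 - M e.1 e.2) / 2 * g e (-1) =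
        ∑ u : ℤˣ, (1 + ((u : ℤ) : ℝ) * M e.1 e.2) / 2 * g e ((u : ℤ) : ℝ) := by
    intro e
    rw [sum_units_int]
    push_cast
    ring
  simp only [h, obsProb, ← prod_mul_distrib]
  rw [prod_univ_sum, Fintype.piFinset_univ, ← (Equiv.curry (Fin n) (Fin d) ℤˣ).sum_comp]
  rfl

/-- The centered and normalized entry, which has conditional mean `0` and conditional
correlation `1` with the entry. -/
noncomputable def dualEntry (M : Matrix (Fin n) (Fin d) ℝ) (Y : SignMatrix n d)
    (e : Fin n × Fin d) : ℝ :=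
  (entry Y e - M e.1 e.2) / (1 - M e.1 e.2 ^ 2)

variable {M : Matrix (Fin n) (Fin d) ℝ}

theorem sum_obsProb_mul_prod_entry (a : Finset (Fin n × Fin d)) :
    ∑ Y, obsProb M Y * ∏ e ∈ a, entry Y e = ∏ e ∈ a, M e.1 e.2 := by
  have := sum_obsProb_mul_prod M (fun e y => if e ∈ a then y else 1)
  simp only [Fintype.prod_ite_mem] at this
  rw [this, ← Fintype.prod_ite_mem a]
  exact prod_congr rfl fun e _ => by split_ifs <;> ring

/-- By conditional independence each edge contributes one factor: 0 on `b \ a`, 1 on `a ∩ b` because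
E[(Y - M) Y] = 1 - M², and M on `a \ b`. -/
theorem sum_obsProb_mul_dualEntry_mul_entry (hM : ∀ i k, M i k ^ 2 < 1)
    (a b : Finset (Fin n × Fin d)) :
    ∑ Y, obsProb M Y * ((∏ e ∈ b, dualEntry M Y e) * ∏ e ∈ a, entry Y e) =
      if b ⊆ a then ∏ e ∈ a \ b, M e.1 e.2 else 0 := by
  have := sum_obsProb_mul_prod M (fun e y =>
    (if e ∈ b then (y - M e.1 e.2) / (1 - M e.1 e.2 ^ 2) else 1) * (if e ∈ a then y else 1))
  simp only [prod_mul_distrib, Fintype.prod_ite_mem] at this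
  simp only [dualEntry]
  rw [this]
  have hne : ∀ e : Fin n × Fin d, 1 - M e.1 e.2 ^ 2 ≠ 0 := fun e => by
    linarith [hM e.1 e.2]
  split_ifs with hba
  · rw [← Fintype.prod_ite_mem (a \ b)]
    refine prod_congr rfl fun e _ => ?_
    have := hne e
    by_cases hb : e ∈ b
    · simp only [hb, hba hb, mem_sdiff, if_true, not_true, and_false, if_false]
      field_simp
      ring
    · by_cases ha : e ∈ a <;> simp only [ha, hb, mem_sdiff, if_true, if_false, not_false_iff,
        and_true] <;> ring
  · obtain ⟨e, hb, ha⟩ := not_subset.1 hba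
    refine prod_eq_zero (mem_univ e) ?_
    have := hne e
    simp only [hb, ha, if_true, if_false]
    field_simp
    ring

/-- An edge in only one of the sets contributes conditional mean 0; a common edge contributes
Var(Y)/(1 - M²)² with Var(Y) = 1 - M². -/
theorem sum_obsProb_mul_dualEntry_mul_dualEntry (hM : ∀ i k, M i k ^ 2 < 1)
    (a b : Finset (Fin n × Fin d)) :
    ∑ Y, obsProb M Y * ((∏ e ∈ a, dualEntry M Y e) * ∏ e ∈ b, dualEntry M Y e) =
      if a = b then ∏ e ∈ a, (1 - M e.1 e.2 ^ 2)⁻¹ else 0 := by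
  have := sum_obsProb_mul_prod M (fun e y =>
    (if e ∈ a then (y - M e.1 e.2) / (1 - M e.1 e.2 ^ 2) else 1) *
      (if e ∈ b then (y - M e.1 e.2) / (1 - M e.1 e.2 ^ 2) else 1))
  simp only [prod_mul_distrib, Fintype.prod_ite_mem] at this
  simp only [dualEntry]
  rw [this]
  have hne : ∀ e : Fin n × Fin d, 1 - M e.1 e.2 ^ 2 ≠ 0 := fun e => by
    linarith [hM e.1 e.2]
  split_ifs with hab
  · subst hab
    rw [← Fintype.prod_ite_mem a]
    refine prod_congr rfl fun e _ => ?_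
    have := hne e
    split_ifs
    · field_simp
      ring
    · ring
  · obtain ⟨e, he⟩ : ∃ e, ¬ (e ∈ a ↔ e ∈ b) := by
      by_contra! h
      exact hab (Finset.ext h)
    refine prod_eq_zero (mem_univ e) ?_
    have := hne e
    by_cases ha : e ∈ a <;> by_cases hb : e ∈ b <;> simp only [ha, hb, if_true, if_false]
    · simp [ha, hb] at he
    · field_simp
      ring
    · field_simp
      ring
    · simp [ha, hb] at he

end Observation

/-! ### Multilinear reduction on sign matrices -/

section Polynomial

variable {n d : ℕ}

theorem entry_pow (Y : SignMatrix n d) (e : Fin n × Fin d) (k : ℕ) :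
    entry Y e ^ k = if Odd k then entry Y e else 1 := by
  rcases Int.units_eq_one_or (Y e.1 e.2) with h | h
  · simp [entry, h]
  · split_ifs with hk
    · simp [entry, h, hk.neg_one_pow]
    · simp [entry, h, (Nat.not_odd_iff_even.1 hk).neg_one_pow]

/-- On sign matrices a polynomial is a combination of multilinear monomials of no larger
degree. -/
theorem polyValue_eq_sum (f : MvPolynomial (Fin n × Fin d) ℝ) (Y : SignMatrix n d) :
    polyValue f Y = ∑ s ∈ f.support, f.coeff s *
      ∏ e ∈ s.support.filter (fun e => Odd (s e)), entry Y e := by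
  rw [polyValue, MvPolynomial.eval_eq]
  refine sum_congr rfl fun s _ => ?_
  rw [prod_filter]
  simp only [entry_pow]

theorem card_odd_le_totalDegree {f : MvPolynomial (Fin n × Fin d) ℝ} {s : Fin n × Fin d →₀ ℕ}
    (hs : s ∈ f.support) : #(s.support.filter fun e => Odd (s e)) ≤ f.totalDegree := by
  refine (card_filter_le _ _).trans (le_trans ?_ (MvPolynomial.le_totalDegree hs))
  rw [card_eq_sum_ones]
  exact sum_le_sum fun e he => Nat.one_le_iff_ne_zero.2 (Finsupp.mem_support_iff.1 he)

end Polynomial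

/-! ### The dual certificate and its second moment -/

section Certificate

variable {n d : ℕ} {lam : ℝ} {Kn Kd : ℕ}

/-- The dual certificate: it has the same correlations with polynomials of degree at most `D`
as the indicator of `z ∈ S`. -/
noncomputable def certificate (n d D : ℕ) (lam : ℝ) (Kn Kd : ℕ) (z : Fin n)
    (S : Finset (Fin n)) (T : Finset (Fin d)) (Y : SignMatrix n d) : ℝ :=
  ∑ b : Finset (Fin n × Fin d) with #b ≤ D,
    rootedCumulant lam ((Kn : ℝ) / n) ((Kd : ℝ) / d) z b *
      ∏ e ∈ b, dualEntry (blockMatrix lam S T) Y e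

theorem blockMatrix_sq_le (S : Finset (Fin n)) (T : Finset (Fin d)) (i : Fin n) (k : Fin d) :
    blockMatrix lam S T i k ^ 2 ≤ lam ^ 2 := by
  unfold blockMatrix
  split_ifs
  · exact le_rfl
  · simpa using sq_nonneg lam

theorem expectation_certificate_mul_prod_entry (hlam : lam ^ 2 < 1) {D : ℕ} (z : Fin n)
    {a : Finset (Fin n × Fin d)} (ha : #a ≤ D) :
    expectation n d lam Kn Kd
        (fun S T Y => certificate n d D lam Kn Kd z S T Y * ∏ e ∈ a, entry Y e) =
      expectation n d lam Kn Kd (fun S _ Y => rowSelected S z * ∏ e ∈ a, entry Y e) := by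
  have hM : ∀ (S : Finset (Fin n)) (T : Finset (Fin d)) i k, blockMatrix lam S T i k ^ 2 < 1 :=
    fun S T i k => (blockMatrix_sq_le S T i k).trans_lt hlam
  have hr : expectation n d lam Kn Kd (fun S _ Y => rowSelected S z * ∏ e ∈ a, entry Y e) =
      rootedMoment lam ((Kn : ℝ) / n) ((Kd : ℝ) / d) z a := by
    rw [← expectation_rowSelected_mul_prod_blockMatrix,
      expectation_eq_of_cond _ _ fun S T => rfl, expectation_eq_of_cond _ _ fun S T => rfl]
    refine sum_congr rfl fun S _ => sum_congr rfl fun T _ => ?_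
    simp only [mul_left_comm _ (rowSelected S z), ← mul_sum]
    rw [sum_obsProb_mul_prod_entry, ← sum_mul, sum_obsProb, one_mul]
  have hterm : ∀ b : Finset (Fin n × Fin d), expectation n d lam Kn Kd (fun S T Y =>
      (∏ e ∈ b, dualEntry (blockMatrix lam S T) Y e) * ∏ e ∈ a, entry Y e) =
        if b ⊆ a then edgeMoment lam ((Kn : ℝ) / n) ((Kd : ℝ) / d) (a \ b) else 0 := by
    intro b
    rw [expectation_eq_of_cond _ _ fun S T =>
      sum_obsProb_mul_dualEntry_mul_entry (hM S T) a b]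
    split_ifs with hba
    · rw [← expectation_prod_blockMatrix, expectation_eq_of_cond _ _ fun S T => rfl]
      refine sum_congr rfl fun S _ => sum_congr rfl fun T _ => ?_
      rw [← sum_mul, sum_obsProb, one_mul]
    · simp
  simp only [certificate, sum_mul, mul_assoc]
  rw [expectation_sum, hr, ← sum_rootedCumulant_mul_edgeMoment]
  simp only [expectation_const_mul, hterm, mul_ite, mul_zero]
  rw [← sum_filter]
  refine sum_congr (Finset.ext fun b => ?_) fun _ _ => rfl
  simp only [mem_filter, mem_univ, true_and, mem_powerset]
  -- The truncation at size `D` loses nothing: every subset of `a` has at most `D` edges.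
  exact ⟨fun h => h.2, fun h => ⟨(card_le_card h).trans ha, h⟩⟩

theorem expectation_certificate_mul_polyValue (hlam : lam ^ 2 < 1) {D : ℕ} (z : Fin n)
    {f : MvPolynomial (Fin n × Fin d) ℝ} (hf : f.totalDegree ≤ D) :
    expectation n d lam Kn Kd
        (fun S T Y => certificate n d D lam Kn Kd z S T Y * polyValue f Y) =
      expectation n d lam Kn Kd (fun S _ Y => rowSelected S z * polyValue f Y) := by
  simp only [polyValue_eq_sum, mul_sum, mul_left_comm _ (MvPolynomial.coeff _ f),
    expectation_sum, expectation_const_mul]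
  refine sum_congr rfl fun s hs => ?_
  rw [expectation_certificate_mul_prod_entry hlam z ((card_odd_le_totalDegree hs).trans hf)]

/-- Conditional orthogonality leaves only the diagonal, and lam² ≤ 1/2 bounds each factor (1 - M²)⁻¹
by 2. -/
theorem expectation_certificate_sq_le (h0 : 0 ≤ lam) (hlam : lam ^ 2 ≤ 1 / 2) (hn : Kn ≤ n)
    (hd : Kd ≤ d) (D : ℕ) (z : Fin n) :
    expectation n d lam Kn Kd (fun S T Y => certificate n d D lam Kn Kd z S T Y ^ 2) ≤
      ∑ b : Finset (Fin n × Fin d) with #b ≤ D,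
        rootedCumulant lam ((Kn : ℝ) / n) ((Kd : ℝ) / d) z b ^ 2 * 2 ^ #b := by
  have h1 : lam ≤ 1 := by nlinarith
  have hM : ∀ (S : Finset (Fin n)) (T : Finset (Fin d)) i k, blockMatrix lam S T i k ^ 2 < 1 :=
    fun S T i k => (blockMatrix_sq_le S T i k).trans_lt (by linarith)
  have hinv : ∀ (S : Finset (Fin n)) (T : Finset (Fin d)) (b : Finset (Fin n × Fin d)),
      ∏ e ∈ b, (1 - blockMatrix lam S T e.1 e.2 ^ 2)⁻¹ ≤ 2 ^ #b := by
    intro S T b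
    rw [← prod_const]
    refine prod_le_prod (fun e _ => ?_) fun e _ => ?_
    · have := hM S T e.1 e.2
      exact inv_nonneg.2 (by linarith)
    · have := blockMatrix_sq_le (lam := lam) S T e.1 e.2
      exact inv_le_of_inv_le₀ (by norm_num) (by linarith)
  have hcond : ∀ (S : Finset (Fin n)) (T : Finset (Fin d)),
      ∑ Y, obsProb (blockMatrix lam S T) Y * certificate n d D lam Kn Kd z S T Y ^ 2 =
        ∑ b : Finset (Fin n × Fin d) with #b ≤ D,
          rootedCumulant lam ((Kn : ℝ) / n) ((Kd : ℝ) / d) z b ^ 2 *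
            ∏ e ∈ b, (1 - blockMatrix lam S T e.1 e.2 ^ 2)⁻¹ := by
    intro S T
    simp only [certificate, sq (∑ b ∈ _, _), sum_mul_sum]
    simp only [mul_sum]
    rw [sum_comm]
    refine sum_congr rfl fun b hb => ?_
    rw [sum_comm]
    have : ∀ b' : Finset (Fin n × Fin d), ∑ Y, obsProb (blockMatrix lam S T) Y *
        (rootedCumulant lam ((Kn : ℝ) / n) ((Kd : ℝ) / d) z b *
          (∏ e ∈ b, dualEntry (blockMatrix lam S T) Y e) *
        (rootedCumulant lam ((Kn : ℝ) / n) ((Kd : ℝ) / d) z b' *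
          ∏ e ∈ b', dualEntry (blockMatrix lam S T) Y e)) =
        rootedCumulant lam ((Kn : ℝ) / n) ((Kd : ℝ) / d) z b *
        rootedCumulant lam ((Kn : ℝ) / n) ((Kd : ℝ) / d) z b' *
        if b = b' then ∏ e ∈ b, (1 - blockMatrix lam S T e.1 e.2 ^ 2)⁻¹ else 0 := by
      intro b'
      rw [← sum_obsProb_mul_dualEntry_mul_dualEntry (hM S T), mul_sum]
      exact sum_congr rfl fun Y _ => by ring
    simp only [this, mul_ite, mul_zero]
    rw [sum_ite_eq, if_pos hb, sq]
  rw [expectation_eq_of_cond _ _ hcond]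
  have hconst := expectation_one (n := n) (d := d) lam Kn Kd
  set B := ∑ b : Finset (Fin n × Fin d) with #b ≤ D,
    rootedCumulant lam ((Kn : ℝ) / n) ((Kd : ℝ) / d) z b ^ 2 * 2 ^ #b with hB
  have hle := expectation_mono (lam := lam) h0 h1 hn hd (g := fun S T _ =>
    ∑ b : Finset (Fin n × Fin d) with #b ≤ D,
      rootedCumulant lam ((Kn : ℝ) / n) ((Kd : ℝ) / d) z b ^ 2 *
        ∏ e ∈ b, (1 - blockMatrix lam S T e.1 e.2 ^ 2)⁻¹) (h := fun _ _ _ => B * 1)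
    fun S T _ => by
      rw [mul_one]
      exact sum_le_sum fun b _ => mul_le_mul_of_nonneg_left (hinv S T b) (sq_nonneg _)
  rw [expectation_const_mul, hconst, mul_one] at hle
  rw [expectation_eq_of_cond _ _ fun S T => rfl] at hle
  simpa only [← sum_mul, sum_obsProb, one_mul] using hle

/-- At size `k` the cumulant bound with the variance factor gives (2(D + 1)²)^k and growth gives p²
(3(D + 1)² eps)^k. Their product is p² (6(D + 1)⁴ eps)^k ≤ p² / 2^k, a geometric series. -/
theorem sum_rootedCumulant_sq_le {p q eps : ℝ} (h0 : 0 ≤ lam) (hp : 0 ≤ p) (hp1 : p ≤ 1)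
    (hq : 0 ≤ q) (hq1 : q ≤ 1) (hlam : lam ^ 2 ≤ eps) (hlp : lam ^ 2 * (n * p ^ 2) ≤ eps)
    (hlq : lam ^ 2 * (d * q ^ 2) ≤ eps) {D : ℕ} (heps : 12 * ((D : ℝ) + 1) ^ 4 * eps ≤ 1)
    (z : Fin n) :
    ∑ b : Finset (Fin n × Fin d) with #b ≤ D, rootedCumulant lam p q z b ^ 2 * 2 ^ #b ≤
      2 * p ^ 2 := by
  have heps0 : 0 ≤ eps := (sq_nonneg lam).trans hlam
  have hterm : ∀ k ∈ range (D + 1), ∀ b ∈ grownSets d z k,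
      rootedCumulant lam p q z b ^ 2 * 2 ^ #b ≤
        (2 * ((D : ℝ) + 1) ^ 2) ^ k * rootedMoment lam p q z b ^ 2 := by
    intro k hk b hb
    have hkD : (k : ℝ) ≤ D := by exact_mod_cast Nat.lt_succ_iff.1 (mem_range.1 hk)
    have habs := abs_rootedCumulant_le (z := z) h0 hp hp1 hq hq1 b
    have hm := rootedMoment_nonneg (z := z) h0 hp hq b
    rw [card_of_mem_grownSets hb] at habs ⊢
    calc rootedCumulant lam p q z b ^ 2 * 2 ^ k
        ≤ (((D : ℝ) + 1) ^ k * rootedMoment lam p q z b) ^ 2 * 2 ^ k := by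
          rw [← sq_abs (rootedCumulant lam p q z b)]
          gcongr
          exact habs.trans (by gcongr)
      _ = (2 * ((D : ℝ) + 1) ^ 2) ^ k * rootedMoment lam p q z b ^ 2 := by
          rw [mul_pow, mul_pow 2, ← pow_mul, ← pow_mul, mul_comm 2 k]
          ring
  calc ∑ b : Finset (Fin n × Fin d) with #b ≤ D, rootedCumulant lam p q z b ^ 2 * 2 ^ #b
      ≤ ∑ b ∈ (range (D + 1)).biUnion (grownSets d z),
          rootedCumulant lam p q z b ^ 2 * 2 ^ #b := by
        -- Discarding zero summands leaves only nonzero cumulants, whose index sets are grown from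
        -- `z`.
        rw [← sum_filter_ne_zero]
        refine sum_le_sum_of_subset_of_nonneg (fun b hb => ?_) fun b _ _ => by positivity
        simp only [mem_filter, mem_univ, true_and] at hb
        refine mem_biUnion.2 ⟨#b, mem_range.2 (by omega),
          mem_grownSets_of_rootedCumulant_ne_zero (lam := lam) (p := p) (q := q) ?_⟩
        intro h
        simp [h] at hb
    _ ≤ ∑ k ∈ range (D + 1), ∑ b ∈ grownSets d z k,
          rootedCumulant lam p q z b ^ 2 * 2 ^ #b :=
        sum_biUnion_le_sum fun b => by positivity
    _ ≤ ∑ k ∈ range (D + 1), p ^ 2 * (1 / 2) ^ k := by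
        refine sum_le_sum fun k hk => (sum_le_sum (hterm k hk)).trans ?_
        rw [← mul_sum]
        calc _ ≤ (2 * ((D : ℝ) + 1) ^ 2) ^ k * (p ^ 2 * (3 * ((D : ℝ) + 1) ^ 2 * eps) ^ k) := by
              gcongr
              exact sum_grownSets_rootedMoment_sq_le hp hp1 hq hq1 hlam hlp hlq
                (Nat.lt_succ_iff.1 (mem_range.1 hk))
          _ = p ^ 2 * (6 * ((D : ℝ) + 1) ^ 4 * eps) ^ k := by
              rw [mul_left_comm, ← mul_pow]
              ring
          _ ≤ p ^ 2 * (1 / 2) ^ k := by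
              gcongr
              linarith
    _ ≤ 2 * p ^ 2 := by
        rw [← mul_sum, mul_comm]
        exact mul_le_mul_of_nonneg_right (sum_geometric_two_le _) (sq_nonneg p)

/-- Duality: a random variable `W` with the same correlation with `f` as the target `x` bounds
the mean square error of `f` from below. -/
theorem expectation_sq_sub_le_of_dual (h0 : 0 ≤ lam) (h1 : lam ≤ 1) (hn : Kn ≤ n) (hd : Kd ≤ d)
    {f x W : Finset (Fin n) → Finset (Fin d) → SignMatrix n d → ℝ}
    (h : expectation n d lam Kn Kd (fun S T Y => W S T Y * f S T Y) =
      expectation n d lam Kn Kd (fun S T Y => x S T Y * f S T Y)) :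
    expectation n d lam Kn Kd (fun S T Y => x S T Y ^ 2) -
        expectation n d lam Kn Kd (fun S T Y => W S T Y ^ 2) ≤
      expectation n d lam Kn Kd (fun S T Y => (f S T Y - x S T Y) ^ 2) := by
  have key : ∀ g : Finset (Fin n) → Finset (Fin d) → SignMatrix n d → ℝ,
      expectation n d lam Kn Kd (fun S T Y => (f S T Y - g S T Y) ^ 2) =
      expectation n d lam Kn Kd (fun S T Y => f S T Y ^ 2) -
        2 * expectation n d lam Kn Kd (fun S T Y => g S T Y * f S T Y) +
        expectation n d lam Kn Kd (fun S T Y => g S T Y ^ 2) := by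
    intro g
    rw [← expectation_const_mul, ← expectation_sub, ← expectation_add]
    congr
    ext S T Y
    ring
  have := expectation_nonneg (g := fun S T Y => (f S T Y - W S T Y) ^ 2) h0 h1 hn hd
    fun _ _ _ => sq_nonneg _
  rw [key W, h] at this
  rw [key x]
  linarith

end Certificate

/-! ### The two targets and the empty-column event -/

section Targets

variable {n d : ℕ} {lam : ℝ} {Kn Kd : ℕ}

theorem sum_subsetProb_mul_rowSelected (p : ℝ) (z : Fin n) :
    ∑ S, subsetProb p S * rowSelected S z = p := by
  simpa [rowSelected] using sum_subsetProb_mul_subset p {z}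

theorem rowSelected_sq (S : Finset (Fin n)) (z : Fin n) :
    rowSelected S z ^ 2 = rowSelected S z := by
  unfold rowSelected
  split_ifs <;> norm_num

/-- The indicator that no column is selected. -/
def noColumn (T : Finset (Fin d)) : ℝ := if T = ∅ then 1 else 0

theorem sum_subsetProb_mul_noColumn (q : ℝ) :
    ∑ T : Finset (Fin d), subsetProb q T * noColumn T = (1 - q) ^ d := by
  simp [noColumn, subsetProb]

theorem expectation_rowSelected_sq (z : Fin n) :
    expectation n d lam Kn Kd (fun S _ _ => rowSelected S z ^ 2) = (Kn : ℝ) / n := by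
  have := expectation_mul_of_indep (lam := lam) (Kn := Kn) (Kd := Kd)
    (fun S : Finset (Fin n) => rowSelected S z) (fun _ : Finset (Fin d) => 1)
  simp only [mul_one, sum_subsetProb_mul_rowSelected, sum_subsetProb] at this
  simpa only [rowSelected_sq] using this

theorem rowPositive_blockMatrix (h : 0 < lam) (S : Finset (Fin n)) (T : Finset (Fin d))
    (z : Fin n) :
    rowPositive (blockMatrix lam S T) z = rowSelected S z * (1 - noColumn T) := by
  have hiff : (∃ k, 0 < blockMatrix lam S T z k) ↔ z ∈ S ∧ T.Nonempty := by
    constructor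
    · rintro ⟨k, hk⟩
      by_cases hzk : z ∈ S ∧ k ∈ T
      · exact ⟨hzk.1, k, hzk.2⟩
      · simp [blockMatrix, hzk] at hk
    · rintro ⟨hz, k, hk⟩
      exact ⟨k, by simpa [blockMatrix, hz, hk] using h⟩
  simp only [rowPositive, hiff, rowSelected, noColumn, nonempty_iff_ne_empty]
  by_cases hz : z ∈ S <;> by_cases hT : T = ∅ <;> simp [hz, hT]

theorem expectation_rowPositive_sq (h : 0 < lam) (z : Fin n) :
    expectation n d lam Kn Kd (fun S T _ => rowPositive (blockMatrix lam S T) z ^ 2) =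
      (Kn : ℝ) / n * (1 - (1 - (Kd : ℝ) / d) ^ d) := by
  have hsq : ∀ T : Finset (Fin d), (1 - noColumn T) ^ 2 = 1 - noColumn T := fun T => by
    unfold noColumn; split_ifs <;> norm_num
  simp only [rowPositive_blockMatrix h, mul_pow, rowSelected_sq, hsq]
  rw [expectation_mul_of_indep (fun S => rowSelected S z) (fun T => 1 - noColumn T),
    sum_subsetProb_mul_rowSelected]
  simp only [mul_sub, mul_one, sum_sub_distrib, sum_subsetProb, sum_subsetProb_mul_noColumn]

/-- Without selected columns the observation carries no information on the selected rows. -/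
theorem expectation_rowSelected_mul_noColumn (z : Fin n) (g : SignMatrix n d → ℝ) :
    expectation n d lam Kn Kd (fun S T Y => rowSelected S z * noColumn T * g Y) =
      expectation n d lam Kn Kd (fun _ T Y => (Kn : ℝ) / n * noColumn T * g Y) := by
  have hcond : ∀ (r : ℝ) (S : Finset (Fin n)) (T : Finset (Fin d)),
      ∑ Y, obsProb (blockMatrix lam S T) Y * (r * noColumn T * g Y) =
        r * (noColumn T * ∑ Y, obsProb 0 Y * g Y) := by
    intro r S T
    by_cases hT : T = ∅
    · have : blockMatrix lam S T = 0 := by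
        ext i k
        simp [blockMatrix, hT]
      rw [this, mul_sum, mul_sum]
      exact sum_congr rfl fun Y _ => by ring
    · simp [noColumn, hT]
  rw [expectation_eq_of_cond _ _ fun S T => hcond (rowSelected S z) S T,
    expectation_eq_of_cond _ _ fun S T => hcond ((Kn : ℝ) / n) S T]
  have hfac : ∀ (r : Finset (Fin n) → ℝ) (v : Finset (Fin d) → ℝ) ,
      ∑ S, ∑ T, subsetProb ((Kn : ℝ) / n) S * subsetProb ((Kd : ℝ) / d) T * (r S * v T) =
        (∑ S, subsetProb ((Kn : ℝ) / n) S * r S) *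
          ∑ T, subsetProb ((Kd : ℝ) / d) T * v T := by
    intro r v
    rw [sum_mul_sum]
    exact sum_congr rfl fun _ _ => sum_congr rfl fun _ _ => by ring
  rw [hfac (fun S => rowSelected S z) fun T => noColumn T * ∑ Y, obsProb 0 Y * g Y,
    hfac (fun _ => (Kn : ℝ) / n) fun T => noColumn T * ∑ Y, obsProb 0 Y * g Y,
    sum_subsetProb_mul_rowSelected, ← sum_mul, sum_subsetProb, one_mul]

/-- Since Kd ≥ 1, (1 - Kd/d)^d ≤ exp(-Kd) ≤ 1/(1 + Kd) ≤ 1/2. -/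
theorem one_sub_div_pow_le_half (hd1 : 1 ≤ Kd) (hd : Kd ≤ d) :
    (1 - (Kd : ℝ) / d) ^ d ≤ 1 / 2 := by
  have hd0 : (0 : ℝ) < d := by exact_mod_cast hd1.trans hd
  have hK : (1 : ℝ) ≤ Kd := by exact_mod_cast hd1
  have hle : (Kd : ℝ) ≤ d := by exact_mod_cast hd
  have h0 : 0 ≤ 1 - (Kd : ℝ) / d := by
    rw [sub_nonneg]
    exact div_le_one_of_le₀ hle hd0.le
  have h1 : 1 - (Kd : ℝ) / d ≤ Real.exp (-((Kd : ℝ) / d)) := by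
    linarith [Real.add_one_le_exp (-((Kd : ℝ) / d))]
  calc (1 - (Kd : ℝ) / d) ^ d ≤ Real.exp (-((Kd : ℝ) / d)) ^ d := pow_le_pow_left₀ h0 h1 d
    _ = Real.exp (-(Kd : ℝ)) := by
        rw [← Real.exp_nat_mul]
        congr 1
        field_simp
    _ = (Real.exp Kd)⁻¹ := Real.exp_neg _
    _ ≤ 1 / 2 := by
        rw [one_div]
        gcongr
        linarith [Real.add_one_le_exp (Kd : ℝ)]

end Targets

/-! ### Lower bounds from the certificate -/

section LowerBound

variable {n d D Kn Kd : ℕ} {lam : ℝ}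

/-- With p = Kn/n, duality leaves p - 2p², which is at least p/2 once p ≤ 1/4. -/
theorem half_expectation_rowSelected_sq_le (h0 : 0 ≤ lam) (hlam : lam ^ 2 ≤ 1 / 2) (hn : Kn ≤ n)
    (hd : Kd ≤ d) (hp : (Kn : ℝ) / n ≤ 1 / 4) (z : Fin n)
    (hW : expectation n d lam Kn Kd (fun S T Y => certificate n d D lam Kn Kd z S T Y ^ 2) ≤
      2 * ((Kn : ℝ) / n) ^ 2)
    {f : MvPolynomial (Fin n × Fin d) ℝ} (hf : f.totalDegree ≤ D) :
    expectation n d lam Kn Kd (fun S _ _ => rowSelected S z ^ 2) / 2 ≤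
      expectation n d lam Kn Kd (fun S _ Y => (polyValue f Y - rowSelected S z) ^ 2) := by
  have hdual := expectation_sq_sub_le_of_dual h0 (by nlinarith) hn hd
    (f := fun _ _ Y => polyValue f Y) (x := fun S _ _ => rowSelected S z)
    (expectation_certificate_mul_polyValue (Kn := Kn) (Kd := Kd) (lam := lam) (by linarith) z hf)
  have hp0 : 0 ≤ (Kn : ℝ) / n := by positivity
  rw [expectation_rowSelected_sq] at hdual ⊢
  nlinarith

/-- Subtracting p 1{T = ∅} from the certificate raises its second moment to at most 6p², while
E[x⋆²] ≥ p/2 when lam > 0; p ≤ 1/24 is what 6p² ≤ p/4 requires. -/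
theorem half_expectation_rowPositive_sq_le (h0 : 0 ≤ lam) (hlam : lam ^ 2 ≤ 1 / 2) (hn : Kn ≤ n)
    (hd1 : 1 ≤ Kd) (hd : Kd ≤ d) (hp : (Kn : ℝ) / n ≤ 1 / 24) (z : Fin n)
    (hW : expectation n d lam Kn Kd (fun S T Y => certificate n d D lam Kn Kd z S T Y ^ 2) ≤
      2 * ((Kn : ℝ) / n) ^ 2)
    {f : MvPolynomial (Fin n × Fin d) ℝ} (hf : f.totalDegree ≤ D) :
    expectation n d lam Kn Kd (fun S T _ => rowPositive (blockMatrix lam S T) z ^ 2) / 2 ≤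
      expectation n d lam Kn Kd
        (fun S T Y => (polyValue f Y - rowPositive (blockMatrix lam S T) z) ^ 2) := by
  have h1 : lam ≤ 1 := by nlinarith
  -- For lam = 0 the target vanishes identically and does not factor as 1{z ∈ S} 1{T ≠ ∅}.
  rcases h0.eq_or_lt with hzero | hpos
  · have hx : ∀ (S : Finset (Fin n)) (T : Finset (Fin d)),
        rowPositive (blockMatrix lam S T) z = 0 := by
      intro S T
      simp [rowPositive, blockMatrix, ← hzero]
    have hl : expectation n d lam Kn Kd
        (fun S T _ => rowPositive (blockMatrix lam S T) z ^ 2) = 0 := by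
      simp [hx, expectation]
    rw [hl, zero_div]
    exact expectation_nonneg h0 h1 hn hd fun _ _ _ => sq_nonneg _
  have hp0 : 0 ≤ (Kn : ℝ) / n := by positivity
  have hcorr : expectation n d lam Kn Kd (fun S T Y =>
        (certificate n d D lam Kn Kd z S T Y - (Kn : ℝ) / n * noColumn T) * polyValue f Y) =
      expectation n d lam Kn Kd
        (fun S T Y => rowPositive (blockMatrix lam S T) z * polyValue f Y) := by
    simp only [rowPositive_blockMatrix hpos, mul_sub, sub_mul, mul_one, expectation_sub]
    rw [expectation_certificate_mul_polyValue (by linarith) z hf,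
      expectation_rowSelected_mul_noColumn]
  have hdual := expectation_sq_sub_le_of_dual h0 h1 hn hd (f := fun _ _ Y => polyValue f Y)
    (x := fun S T _ => rowPositive (blockMatrix lam S T) z) hcorr
  have hW' : expectation n d lam Kn Kd (fun S T Y =>
        (certificate n d D lam Kn Kd z S T Y - (Kn : ℝ) / n * noColumn T) ^ 2) ≤
      6 * ((Kn : ℝ) / n) ^ 2 := by
    have hle := expectation_mono (lam := lam) h0 h1 hn hd
      (g := fun S T Y =>
        (certificate n d D lam Kn Kd z S T Y - (Kn : ℝ) / n * noColumn T) ^ 2)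
      (h := fun S T Y => 2 * certificate n d D lam Kn Kd z S T Y ^ 2 +
        2 * ((Kn : ℝ) / n) ^ 2 * 1) fun S T Y => by
        have hc : noColumn T ^ 2 ≤ 1 := by unfold noColumn; split_ifs <;> norm_num
        have hpc : ((Kn : ℝ) / n * noColumn T) ^ 2 ≤ ((Kn : ℝ) / n) ^ 2 := by
          rw [mul_pow]
          exact mul_le_of_le_one_right (sq_nonneg _) hc
        nlinarith [sq_nonneg (certificate n d D lam Kn Kd z S T Y + (Kn : ℝ) / n * noColumn T)]
    rw [expectation_add, expectation_const_mul, expectation_const_mul, expectation_one] at hle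
    linarith
  have hhalf := one_sub_div_pow_le_half hd1 hd
  rw [expectation_rowPositive_sq hpos] at hdual ⊢
  nlinarith

end LowerBound

end HiddenBlock

theorem mainTheorem1 :
    ∃ c₀ : ℝ, 0 < c₀ ∧ ∀ c : ℝ, c₀ ≤ c →
      ∀ (n d D Kn Kd : ℕ) (lam : ℝ) (hn : 0 < n),
        2 ≤ D → 1 ≤ Kn → Kn ≤ n → 1 ≤ Kd → Kd ≤ d → 0 ≤ lam →
        HiddenBlock.SignalCondition n d D lam Kn Kd c →
        ∀ f : MvPolynomial (Fin n × Fin d) ℝ, f.totalDegree ≤ D →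
          (HiddenBlock.expectation n d lam Kn Kd (fun S T _ =>
                (HiddenBlock.rowPositive (HiddenBlock.blockMatrix lam S T) ⟨0, hn⟩) ^ 2) / 2
              ≤ HiddenBlock.expectation n d lam Kn Kd (fun S T Y =>
                (HiddenBlock.polyValue f Y
                  - HiddenBlock.rowPositive (HiddenBlock.blockMatrix lam S T) ⟨0, hn⟩) ^ 2)) ∧
          (HiddenBlock.expectation n d lam Kn Kd (fun S _ _ =>
                (HiddenBlock.rowSelected S ⟨0, hn⟩) ^ 2) / 2
              ≤ HiddenBlock.expectation n d lam Kn Kd (fun S _ Y =>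
                (HiddenBlock.polyValue f Y - HiddenBlock.rowSelected S ⟨0, hn⟩) ^ 2)) := by
  -- c₀ = 1 suffices: it gives the threshold eps = D⁻⁸, and the growth lemmas are applied with eps².
  refine ⟨1, one_pos, fun c hc n d D Kn Kd lam hn0 hD _ hn hd1 hd h0 hsig f hf => ?_⟩
  have hD2 : (2 : ℝ) ≤ D := by exact_mod_cast hD
  have hd0 : (0 : ℝ) < d := by exact_mod_cast hd1.trans hd
  have hn' : (0 : ℝ) < n := by exact_mod_cast hn0
  set eps : ℝ := ((D : ℝ) ^ 8)⁻¹ with heps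
  have hpow : (D : ℝ) ^ (-8 * c) ≤ eps := by
    rw [heps, ← Real.rpow_natCast, ← Real.rpow_neg (by positivity)]
    exact Real.rpow_le_rpow_of_exponent_le (by linarith) (by push_cast; linarith)
  have heps0 : 0 < eps := by positivity
  have heps1 : eps ≤ 1 / 256 := by
    rw [heps, one_div]
    gcongr
    calc (256 : ℝ) = 2 ^ 8 := by norm_num
      _ ≤ (D : ℝ) ^ 8 := by gcongr
  simp only [HiddenBlock.SignalCondition, max_le_iff] at hsig
  obtain ⟨⟨⟨⟨hp, hq⟩, hlp⟩, hlq⟩, hlam⟩ := hsig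
  replace hp := hp.trans hpow
  replace hq := hq.trans hpow
  replace hlp := hlp.trans hpow
  replace hlq := hlq.trans hpow
  replace hlam := hlam.trans hpow
  have hscale : ∀ {m K : ℝ}, 0 < m → 0 ≤ K → lam * K / Real.sqrt m ≤ eps →
      lam ^ 2 * (m * (K / m) ^ 2) ≤ eps ^ 2 := by
    intro m K hm hK h
    calc lam ^ 2 * (m * (K / m) ^ 2) = (lam * K / Real.sqrt m) ^ 2 := by
          rw [div_pow, div_pow (lam * K), Real.sq_sqrt hm.le]
          field_simp
      _ ≤ eps ^ 2 := by gcongr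
  have hlam2 : lam ^ 2 ≤ eps ^ 2 := by gcongr
  -- From D + 1 ≤ 2D the left side is at most 192 D⁴ / D¹⁶, and D ≥ 2 gives D¹² ≥ 2¹² ≥ 192.
  have hbound : 12 * ((D : ℝ) + 1) ^ 4 * eps ^ 2 ≤ 1 := by
    have h1 : ((D : ℝ) + 1) ^ 4 ≤ (2 * D) ^ 4 := by gcongr; linarith
    have h2 : (192 : ℝ) * D ^ 4 ≤ (D ^ 8) ^ 2 := by
      calc (192 : ℝ) * (D : ℝ) ^ 4 ≤ 2 ^ 12 * (D : ℝ) ^ 4 := by gcongr; norm_num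
        _ ≤ (D : ℝ) ^ 12 * (D : ℝ) ^ 4 := by gcongr
        _ = ((D : ℝ) ^ 8) ^ 2 := by ring
    rw [heps, inv_pow, ← div_eq_mul_inv, div_le_one (by positivity)]
    linarith [h1, h2, mul_pow (2 : ℝ) D 4]
  have hhalf : lam ^ 2 ≤ 1 / 2 := by nlinarith
  have hW := (HiddenBlock.expectation_certificate_sq_le (D := D) h0 hhalf hn hd
    ⟨0, hn0⟩).trans (HiddenBlock.sum_rootedCumulant_sq_le h0 (by positivity) (by linarith)
      (by positivity) (by linarith) hlam2 (hscale hn' (by positivity) hlp)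
      (hscale hd0 (by positivity) hlq) hbound ⟨0, hn0⟩)
  exact ⟨HiddenBlock.half_expectation_rowPositive_sq_le h0 hhalf hn hd1 hd (by linarith) _ hW hf,
    HiddenBlock.half_expectation_rowSelected_sq_le h0 hhalf hn hd (by linarith) _ hW hf⟩
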